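/- Let $(p_{i,j})_{-1\le i,j\le 1}$ be non-negative real numbers with sum $1$ such that (H1) $p_{0,0}=0$ (they are the transition probabilities, in the interior of the quarter plane $\mathbf Z_+^2$, of a homogeneous random walk with jumps to the eight nearest neighbors); (H2) in the cyclic list $p_{1,1},p_{1,0},p_{1,-1},p_{0,-1},p_{-1,-1},p_{-1,0},p_{-1,1},p_{0,1}$ there are no three consecutive zeros; (H3) $\sum_{-1\le i,j\le 1} i\,p_{i,j}=0$ and $\sum_{-1\le i,j\le 1} j\,p_{i,j}=0$. Let $f:\mathbf Z_+^2\to\mathbf R$ be a positive harmonic function for the walk killed at the boundary, that is: $f(i_0,j_0)=\sum_{-1\le i,j\le 1}p_{i,j}f(i_0+i,j_0+j)$ for all $i_0,j_0\ge 1$; $f(i_0,j_0)=0$ if $i_0j_0=0$; and $f(i_0,j_0)>0$ if $i_0,j_0>0$. Put $H(x,y)=\sum_{i_0,j_0\ge 1}f(i_0,j_0)x^{i_0-1}y^{j_0-1}$, so that $$H(x,0)=\sum_{i_0\ge 1}f(i_0,1)x^{i_0-1},\qquad H(0,y)=\sum_{j_0\ge 1}f(1,j_0)y^{j_0-1}.$$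 Then both power series $H(x,0)$ and $H(0,y)$ have radius of convergence exactly $1$, and $H(1,0)=H(0,1)=\infty$, i.e. $\sum_{i_0\ge1}f(i_0,1)=\sum_{j_0\ge1}f(1,j_0)=\infty$. -/

import Mathlib

open scoped ENNReal

namespace QuarterPlane

/-- The family `p i j`, `-1 ≤ i, j ≤ 1`, is the family of transition probabilities of a small-step
walk to the eight nearest neighbours (values of `p` outside this square are never used). -/
structure IsSmallStep (p : ℤ → ℤ → ℝ) : Prop where
  nonneg : ∀ i ∈ Finset.Icc (-1 : ℤ) 1, ∀ j ∈ Finset.Icc (-1 : ℤ) 1, 0 ≤ p i j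
  sum_eq_one : ∑ i ∈ Finset.Icc (-1 : ℤ) 1, ∑ j ∈ Finset.Icc (-1 : ℤ) 1, p i j = 1
  zero_zero : p 0 0 = 0

/-- The eight weights listed clockwise:
`p₁₁, p₁₀, p₁₋₁, p₀₋₁, p₋₁₋₁, p₋₁₀, p₋₁₁, p₀₁`. -/
def weightList (p : ℤ → ℤ → ℝ) : Fin 8 → ℝ :=
  ![p 1 1, p 1 0, p 1 (-1), p 0 (-1), p (-1) (-1), p (-1) 0, p (-1) 1, p 0 1]

/-- No three (cyclically) consecutive zeros in the list of weights; addition in `Fin 8` wraps. -/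
def IsNonDegenerate (p : ℤ → ℤ → ℝ) : Prop :=
  ∀ k : Fin 8, ¬ (weightList p k = 0 ∧ weightList p (k + 1) = 0 ∧ weightList p (k + 2) = 0)

/-- Both coordinates of the drift vanish. -/
def HasZeroDrift (p : ℤ → ℤ → ℝ) : Prop :=
  ∑ i ∈ Finset.Icc (-1 : ℤ) 1, ∑ j ∈ Finset.Icc (-1 : ℤ) 1, (i : ℝ) * p i j = 0 ∧
  ∑ i ∈ Finset.Icc (-1 : ℤ) 1, ∑ j ∈ Finset.Icc (-1 : ℤ) 1, (j : ℝ) * p i j = 0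

/-- `f` is harmonic for the walk at the interior points, zero on the boundary of the quarter plane
and positive in its interior. Since `a, b ≥ 1`, no truncation occurs in `Int.toNat`. -/
structure IsPositiveHarmonic (p : ℤ → ℤ → ℝ) (f : ℕ → ℕ → ℝ) : Prop where
  harmonic : ∀ a b : ℕ, 1 ≤ a → 1 ≤ b →
    f a b = ∑ i ∈ Finset.Icc (-1 : ℤ) 1, ∑ j ∈ Finset.Icc (-1 : ℤ) 1,
      p i j * f ((a : ℤ) + i).toNat ((b : ℤ) + j).toNat
  zero_boundary : ∀ a b : ℕ, a * b = 0 → f a b = 0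
  pos : ∀ a b : ℕ, 0 < a → 0 < b → 0 < f a b

/-- The power series `H(x,0) = ∑_{a ≥ 1} f(a,1) x^(a-1)`. -/
noncomputable def seriesX (f : ℕ → ℕ → ℝ) : FormalMultilinearSeries ℂ ℂ ℂ :=
  FormalMultilinearSeries.ofScalars ℂ (fun n : ℕ => ((f (n + 1) 1 : ℝ) : ℂ))

/-- The power series `H(0,y) = ∑_{b ≥ 1} f(1,b) y^(b-1)`. -/
noncomputable def seriesY (f : ℕ → ℕ → ℝ) : FormalMultilinearSeries ℂ ℂ ℂ :=
  FormalMultilinearSeries.ofScalars ℂ (fun n : ℕ => ((f 1 (n + 1) : ℝ) : ℂ))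

/-- The value `H(x,y) = ∑_{a,b ≥ 1} f(a,b) x^(a-1) y^(b-1)` in `[0,∞]`, for nonnegative `x`, `y`
and for `f` nonnegative. -/
noncomputable def value (f : ℕ → ℕ → ℝ) (x y : ℝ≥0∞) : ℝ≥0∞ :=
  ∑' a : ℕ, ∑' b : ℕ, ENNReal.ofReal (f (a + 1) (b + 1)) * x ^ a * y ^ b

theorem value_one_zero (f : ℕ → ℕ → ℝ) :
    value f 1 0 = ∑' a : ℕ, ENNReal.ofReal (f (a + 1) 1) := by
  unfold value
  refine tsum_congr fun a => ?_
  rw [tsum_eq_single 0]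
  · simp
  · intro b hb
    simp [hb]

theorem value_zero_one (f : ℕ → ℕ → ℝ) :
    value f 0 1 = ∑' b : ℕ, ENNReal.ofReal (f 1 (b + 1)) := by
  unfold value
  rw [tsum_eq_single 0]
  · simp
  · intro a ha
    simp [ha]

end QuarterPlane

/-! For fixed `y`, the column sums `∑_b f(a,b) y^b` satisfy in `a` a three-term recurrence with
constant coefficients, forced by the bottom row (`colSum_recurrence`). Since the drift is zero and
the jumps do not all lie on one line, the kernel is positive for `0 < y < 1` (`one_lt_kernel`). The
recurrence thus has no positive characteristic root, and free solutions oscillate, whereas column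
sums are nonnegative.

Radius at least 1: if the first column had radius `R < 1`, its partial sums just beyond `R` would be
arbitrarily large. Dividing all columns by them kills the forcing and, at well-chosen truncation
levels (`exists_partial_sum_window`), the truncation errors. The limit is a nonnegative free
solution at `R`, contradicting `not_nonneg_of_oscillating`.

Divergence at 1: as `y → 1`, the angle `φ` of the characteristic roots tends to 0. At the index
where the phase is close to `3π/2` the free part is negative, so the forcing must compensate it. If
the bottom row were summable, its early terms would enter with the wrong sign and its tail would be
too small. Divergence also bounds the radius by 1. Exchanging the coordinates gives the other axis.
-/

namespace QuarterPlane

/-! ### Hypotheses and diagonal symmetry -/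

/-- The standing assumptions on the walk `p` and the harmonic function `f`. -/
structure Model (p : ℤ → ℤ → ℝ) (f : ℕ → ℕ → ℝ) : Prop where
  step : IsSmallStep p
  nondeg : IsNonDegenerate p
  drift : HasZeroDrift p
  harm : IsPositiveHarmonic p f

theorem sum_Icc_neg_one_one (g : ℤ → ℝ) :
    ∑ i ∈ Finset.Icc (-1 : ℤ) 1, g i = g (-1) + g 0 + g 1 := by
  have h : Finset.Icc (-1 : ℤ) 1 = {-1, 0, 1} := by decide
  rw [h, Finset.sum_insert (by decide), Finset.sum_insert (by decide), Finset.sum_singleton]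
  ring

/-- Transposition acts on the cyclic list as `k ↦ -k`, so the window starting at `k` becomes the one
starting at `-(k + 2)`, read backwards. -/
theorem IsNonDegenerate.swap {p : ℤ → ℤ → ℝ} (h : IsNonDegenerate p) :
    IsNonDegenerate fun i j => p j i := by
  have e : ∀ k, weightList (fun i j => p j i) k = weightList p (-k) := fun k => by
    fin_cases k <;> rfl
  rintro k ⟨x, y, z⟩
  rw [e] at x y z
  refine h (-(k + 2)) ⟨z, ?_, ?_⟩
  · rwa [show -(k + 2) + 1 = -(k + 1) by clear x y z; revert k; decide]
  · rwa [show -(k + 2) + 2 = -k by clear x y z; revert k; decide]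

theorem Model.swap {p : ℤ → ℤ → ℝ} {f : ℕ → ℕ → ℝ} (h : Model p f) :
    Model (fun i j => p j i) (fun a b => f b a) where
  step :=
    { nonneg := fun i hi j hj => h.step.nonneg j hj i hi
      sum_eq_one := by rw [Finset.sum_comm]; exact h.step.sum_eq_one
      zero_zero := h.step.zero_zero }
  nondeg := h.nondeg.swap
  drift := by
    constructor
    · rw [Finset.sum_comm]; exact h.drift.2
    · rw [Finset.sum_comm]; exact h.drift.1
  harm :=
    { harmonic := fun a b ha hb => by rw [Finset.sum_comm]; exact h.harm.harmonic b a hb ha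
      zero_boundary := fun a b hab => h.harm.zero_boundary b a (by rw [mul_comm]; exact hab)
      pos := fun a b ha hb => h.harm.pos b a hb ha }

/-! ### Truncated column sums and their recurrence -/

/-- The contribution of the jumps with a given horizontal part. -/
def colStep (p : ℤ → ℤ → ℝ) (f : ℕ → ℕ → ℝ) (i : ℤ) (a b : ℕ) : ℝ :=
  p i 1 * f a (b + 2) + p i 0 * f a (b + 1) + p i (-1) * f a b

/-- The generating polynomial of the weights with a given horizontal part. -/
noncomputable def colWeight (p : ℤ → ℤ → ℝ) (i : ℤ) (y : ℝ) : ℝ :=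
  p i 1 / y + p i 0 + p i (-1) * y

/-- Truncation of the generating function of the `a`-th column of `f`. -/
def colSum (f : ℕ → ℕ → ℝ) (y : ℝ) (a N : ℕ) : ℝ :=
  ∑ b ∈ Finset.range N, f a (b + 1) * y ^ (b + 1)

/-- The upper truncation term of a column. -/
def topTerm (p : ℤ → ℤ → ℝ) (f : ℕ → ℕ → ℝ) (y : ℝ) (N : ℕ) (i : ℤ) (a : ℕ) : ℝ :=
  p i 1 * f a (N + 1) * y ^ N - p i (-1) * f a N * y ^ (N + 1)

/-- The total truncation term in the recurrence for the columns. -/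
def topError (p : ℤ → ℤ → ℝ) (f : ℕ → ℕ → ℝ) (y : ℝ) (N a : ℕ) : ℝ :=
  topTerm p f y N 1 (a + 2) + topTerm p f y N 0 (a + 1) + topTerm p f y N (-1) a

/-- The forcing term coming from the bottom row. -/
def forcing (p : ℤ → ℤ → ℝ) (f : ℕ → ℕ → ℝ) (a : ℕ) : ℝ :=
  p 1 1 * f (a + 2) 1 + p 0 1 * f (a + 1) 1 + p (-1) 1 * f a 1

namespace Model

variable {p : ℤ → ℤ → ℝ} {f : ℕ → ℕ → ℝ}

theorem p_nonneg (h : Model p f) {i j : ℤ} (hi : i ∈ Finset.Icc (-1 : ℤ) 1)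
    (hj : j ∈ Finset.Icc (-1 : ℤ) 1) : 0 ≤ p i j := h.step.nonneg i hi j hj

theorem all_nonneg (h : Model p f) : 0 ≤ p 1 1 ∧ 0 ≤ p 1 0 ∧ 0 ≤ p 1 (-1) ∧ 0 ≤ p 0 (-1) ∧
    0 ≤ p (-1) (-1) ∧ 0 ≤ p (-1) 0 ∧ 0 ≤ p (-1) 1 ∧ 0 ≤ p 0 1 := by
  refine ⟨?_, ?_, ?_, ?_, ?_, ?_, ?_, ?_⟩ <;> exact h.p_nonneg (by decide) (by decide)

/-- Any three consecutive weights have a positive sum. -/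
theorem windows (h : Model p f) :
    0 < p 1 1 + p 1 0 + p 1 (-1) ∧ 0 < p 1 0 + p 1 (-1) + p 0 (-1) ∧
    0 < p (-1) (-1) + p (-1) 0 + p (-1) 1 ∧
    0 < p (-1) 0 + p (-1) 1 + p 0 1 ∧ 0 < p (-1) 1 + p 0 1 + p 1 1 ∧
    0 < p 0 1 + p 1 1 + p 1 0 := by
  obtain ⟨a1, a2, a3, a4, a5, a6, a7, a8⟩ := h.all_nonneg
  have key : ∀ {x y z : ℝ}, 0 ≤ x → 0 ≤ y → 0 ≤ z → ¬ (x = 0 ∧ y = 0 ∧ z = 0) →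
      0 < x + y + z := by
    intro x y z hx hy hz hn
    refine lt_of_le_of_ne (by positivity) fun he => hn ⟨?_, ?_, ?_⟩ <;> linarith
  exact ⟨key a1 a2 a3 (h.nondeg 0), key a2 a3 a4 (h.nondeg 1), key a5 a6 a7 (h.nondeg 4),
    key a6 a7 a8 (h.nondeg 5), key a7 a8 a1 (h.nondeg 6), key a8 a1 a2 (h.nondeg 7)⟩

theorem sum_eq_one (h : Model p f) : p 1 1 + p 1 0 + p 1 (-1) + p 0 (-1) + p (-1) (-1) +
    p (-1) 0 + p (-1) 1 + p 0 1 = 1 := by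
  have := h.step.sum_eq_one
  simp only [sum_Icc_neg_one_one, h.step.zero_zero] at this
  linarith

theorem drift_fst (h : Model p f) :
    p 1 1 + p 1 0 + p 1 (-1) = p (-1) (-1) + p (-1) 0 + p (-1) 1 := by
  have := h.drift.1
  simp only [sum_Icc_neg_one_one] at this
  push_cast at this
  linarith

theorem drift_snd (h : Model p f) :
    p (-1) 1 + p 0 1 + p 1 1 = p (-1) (-1) + p 0 (-1) + p 1 (-1) := by
  have := h.drift.2
  simp only [sum_Icc_neg_one_one] at this
  push_cast at this
  linarith

theorem f_nonneg (h : Model p f) (a b : ℕ) : 0 ≤ f a b := by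
  rcases Nat.eq_zero_or_pos (a * b) with h0 | h0
  · exact (h.harm.zero_boundary a b h0).ge
  · exact (h.harm.pos a b (Nat.pos_of_mul_pos_right h0) (Nat.pos_of_mul_pos_left h0)).le

theorem f_zero_left (h : Model p f) (b : ℕ) : f 0 b = 0 := h.harm.zero_boundary 0 b (by simp)

theorem f_zero_right (h : Model p f) (a : ℕ) : f a 0 = 0 := h.harm.zero_boundary a 0 (by simp)

theorem harmonic_eq (h : Model p f) (a b : ℕ) :
    f (a + 1) (b + 1) =
      colStep p f 1 (a + 2) b + colStep p f 0 (a + 1) b + colStep p f (-1) a b := by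
  have key := h.harm.harmonic (a + 1) (b + 1) (by omega) (by omega)
  have e1 : ∀ n : ℕ, (((n + 1 : ℕ) : ℤ) + -1).toNat = n := fun n => by omega
  have e2 : ∀ n : ℕ, (((n + 1 : ℕ) : ℤ) + 0).toNat = n + 1 := fun n => by omega
  have e3 : ∀ n : ℕ, (((n + 1 : ℕ) : ℤ) + 1).toNat = n + 2 := fun n => by omega
  simp only [sum_Icc_neg_one_one, e1, e2, e3] at key
  rw [key]
  simp only [colStep]
  ring

theorem sum_colStep (h : Model p f) {y : ℝ} (hy : y ≠ 0) (i : ℤ) (a N : ℕ) :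
    ∑ b ∈ Finset.range N, colStep p f i a b * y ^ (b + 1) =
      colWeight p i y * colSum f y a N - p i 1 * f a 1 + topTerm p f y N i a := by
  induction N with
  | zero => simp [colSum, topTerm, h.f_zero_right]
  | succ N ih =>
    rw [Finset.sum_range_succ, ih]
    simp only [colSum, Finset.sum_range_succ, colStep, colWeight, topTerm]
    field_simp
    ring

/-- Truncation keeps every sum finite before any convergence is known; the price is `topError`. -/
theorem colSum_recurrence (h : Model p f) {y : ℝ} (hy : y ≠ 0) (a N : ℕ) :
    colWeight p 1 y * colSum f y (a + 2) N - (1 - colWeight p 0 y) * colSum f y (a + 1) N +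
      colWeight p (-1) y * colSum f y a N = forcing p f a - topError p f y N a := by
  have key : colSum f y (a + 1) N =
      ∑ b ∈ Finset.range N, colStep p f 1 (a + 2) b * y ^ (b + 1) +
      ∑ b ∈ Finset.range N, colStep p f 0 (a + 1) b * y ^ (b + 1) +
      ∑ b ∈ Finset.range N, colStep p f (-1) a b * y ^ (b + 1) := by
    rw [← Finset.sum_add_distrib, ← Finset.sum_add_distrib, colSum]
    refine Finset.sum_congr rfl fun b _ => ?_
    rw [h.harmonic_eq]
    ring
  rw [h.sum_colStep hy, h.sum_colStep hy, h.sum_colStep hy] at key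
  simp only [forcing, topError]
  linarith

theorem colSum_zero (h : Model p f) (y : ℝ) (N : ℕ) : colSum f y 0 N = 0 := by
  simp [colSum, h.f_zero_left]

theorem colSum_nonneg (h : Model p f) {y : ℝ} (hy : 0 ≤ y) (a N : ℕ) : 0 ≤ colSum f y a N :=
  Finset.sum_nonneg fun _ _ => mul_nonneg (h.f_nonneg _ _) (pow_nonneg hy _)

theorem forcing_nonneg (h : Model p f) (a : ℕ) : 0 ≤ forcing p f a := by
  obtain ⟨a1, -, -, -, -, -, a7, a8⟩ := h.all_nonneg
  have := h.f_nonneg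
  exact add_nonneg (add_nonneg (mul_nonneg a1 (this _ _)) (mul_nonneg a8 (this _ _)))
    (mul_nonneg a7 (this _ _))

/-! ### Harnack-type comparisons -/

/-- All terms of the harmonic sum are nonnegative, so each is at most the whole. -/
theorem mul_f_le (h : Model p f) {i j : ℤ} (hi : i ∈ Finset.Icc (-1 : ℤ) 1)
    (hj : j ∈ Finset.Icc (-1 : ℤ) 1) {a b : ℕ} (ha : 1 ≤ a) (hb : 1 ≤ b) {a' b' : ℕ}
    (ha' : (a : ℤ) + i = a') (hb' : (b : ℤ) + j = b') : p i j * f a' b' ≤ f a b := by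
  rw [h.harm.harmonic a b ha hb]
  have hn : ∀ i ∈ Finset.Icc (-1 : ℤ) 1, ∀ j ∈ Finset.Icc (-1 : ℤ) 1,
      0 ≤ p i j * f ((a : ℤ) + i).toNat ((b : ℤ) + j).toNat :=
    fun i hi j hj => mul_nonneg (h.p_nonneg hi hj) (h.f_nonneg _ _)
  have e : p i j * f a' b' = p i j * f ((a : ℤ) + i).toNat ((b : ℤ) + j).toNat := by
    rw [ha', hb']; simp
  rw [e]
  exact (Finset.single_le_sum (f := fun j => p i j * f ((a : ℤ) + i).toNat ((b : ℤ) + j).toNat)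
    (hn i hi) hj).trans (Finset.single_le_sum
    (f := fun i => ∑ j ∈ Finset.Icc (-1 : ℤ) 1, p i j * f ((a : ℤ) + i).toNat ((b : ℤ) + j).toNat)
    (fun i hi => Finset.sum_nonneg (hn i hi)) hi)

theorem f_le_of_step (h : Model p f) {i j : ℤ} (hi : i ∈ Finset.Icc (-1 : ℤ) 1)
    (hj : j ∈ Finset.Icc (-1 : ℤ) 1) (hp : 0 < p i j) {a b : ℕ} (ha : 1 ≤ a) (hb : 1 ≤ b)
    {a' b' : ℕ} (ha' : (a : ℤ) + i = a') (hb' : (b : ℤ) + j = b') :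
    f a' b' ≤ (p i j)⁻¹ * f a b := by
  rw [inv_mul_eq_div, le_div_iff₀ hp, mul_comm]
  exact h.mul_f_le hi hj ha hb ha' hb'

/-- Every column is dominated by the first one. -/
theorem f_le_first_column (h : Model p f) (k : ℕ) : ∃ C : ℝ, 0 < C ∧ ∀ N : ℕ, k + 1 ≤ N →
    ∃ b : ℕ, 1 ≤ b ∧ N ≤ b + k ∧ b ≤ N + k ∧ f (k + 1) N ≤ C * f 1 b := by
  -- (H2) provides a jump to the right. Each column crossed shifts the height by at most one, whence
  -- the tolerance `k`.
  obtain ⟨j, hj, hp⟩ : ∃ j ∈ Finset.Icc (-1 : ℤ) 1, 0 < p 1 j := by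
    by_contra! hc
    have := hc 1 (by decide)
    have := hc 0 (by decide)
    have := hc (-1) (by decide)
    linarith [h.windows.1]
  have hj' := Finset.mem_Icc.1 hj
  induction k with
  | zero => exact ⟨1, one_pos, fun N hN => ⟨N, hN, by omega, by omega, by simp⟩⟩
  | succ k ih =>
    obtain ⟨C, hC, ih⟩ := ih
    refine ⟨(p 1 j)⁻¹ * C, by positivity, fun N hN => ?_⟩
    obtain ⟨M, hM⟩ : ∃ M : ℕ, (M : ℤ) + j = N := ⟨((N : ℤ) - j).toNat, by omega⟩
    obtain ⟨b, hb0, hb1, hb2, hb⟩ := ih M (by omega)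
    refine ⟨b, hb0, by omega, by omega, ?_⟩
    have := h.f_le_of_step (i := 1) (by decide) hj hp (a := k + 1) (by omega) (b := M) (by omega)
      (a' := k + 2) (by push_cast; ring) hM
    calc f (k + 1 + 1) N ≤ (p 1 j)⁻¹ * f (k + 1) M := this
      _ ≤ (p 1 j)⁻¹ * (C * f 1 b) := by gcongr
      _ = _ := by ring

/-- A bounded number of steps leads upwards along the first column. -/
theorem f_first_column_up (h : Model p f) : ∃ d : ℕ, ∃ C : ℝ, 1 ≤ d ∧ 0 < C ∧
    ∀ N : ℕ, 1 ≤ N → f 1 (N + d) ≤ C * f 1 N := by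
  obtain ⟨a1, a2, a3, a4, a5, a6, a7, a8⟩ := h.all_nonneg
  obtain ⟨-, -, -, w4, w5, w6⟩ := h.windows
  -- When no vertical jump upwards is available, a jump right followed by a jump left, neither going
  -- down, returns to the first column.
  have two : ∀ {j j' : ℤ} {d : ℕ}, j ∈ Finset.Icc (0 : ℤ) 1 → j' ∈ Finset.Icc (0 : ℤ) 1 →
      0 < p 1 j → 0 < p (-1) j' → j + j' = d → ∀ N : ℕ, 1 ≤ N →
      f 1 (N + d) ≤ ((p (-1) j')⁻¹ * (p 1 j)⁻¹) * f 1 N := by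
    intro j j' d hj hj' hp hp' hd N hN
    rw [Finset.mem_Icc] at hj hj'
    obtain ⟨M, hM⟩ : ∃ M : ℕ, (N : ℤ) + j = M := ⟨((N : ℤ) + j).toNat, by omega⟩
    have s1 := h.f_le_of_step (i := 1) (by decide) (j := j) (Finset.mem_Icc.2 (by omega)) hp
      (a := 1) le_rfl hN (a' := 2) (by norm_num) hM
    have s2 := h.f_le_of_step (i := -1) (by decide) (j := j') (Finset.mem_Icc.2 (by omega)) hp'
      (a := 2) (by norm_num) (b := M) (by omega) (a' := 1) (by norm_num) (b' := N + d)
      (by push_cast; omega)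
    calc f 1 (N + d) ≤ (p (-1) j')⁻¹ * f 2 M := s2
      _ ≤ (p (-1) j')⁻¹ * ((p 1 j)⁻¹ * f 1 N) := by gcongr
      _ = _ := by ring
  rcases a8.lt_or_eq with h01 | h01
  · exact ⟨1, (p 0 1)⁻¹, le_rfl, by positivity, fun N hN => h.f_le_of_step (by decide)
      (by decide) h01 le_rfl hN (by norm_num) (by norm_num)⟩
  rcases a7.lt_or_eq with hm1 | hm1
  · rcases a1.lt_or_eq with h11 | h11
    · exact ⟨2, _, by norm_num, by positivity,
        two (j := 1) (j' := 1) (by decide) (by decide) h11 hm1 (by norm_num)⟩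
    · have h10 : 0 < p 1 0 := by linarith
      exact ⟨1, _, by norm_num, by positivity,
        two (j := 0) (j' := 1) (by decide) (by decide) h10 hm1 (by norm_num)⟩
  · have h11 : 0 < p 1 1 := by linarith
    have hm0 : 0 < p (-1) 0 := by linarith
    exact ⟨1, _, by norm_num, by positivity,
      two (j := 1) (j' := 0) (by decide) (by decide) h11 hm0 (by norm_num)⟩

/-- The choice `y = 1 / (C + 1)` makes `C * y ^ d ≤ 1`, so the bound propagates by steps of `d`. It
shows that the radius of the first column is positive. -/
theorem exists_geometric_bound (h : Model p f) :
    ∃ y : ℝ, 0 < y ∧ ∃ C : ℝ, ∀ N : ℕ, f 1 N * y ^ N ≤ C := by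
  obtain ⟨d, C, hd, hC, hup⟩ := h.f_first_column_up
  set y : ℝ := (C + 1)⁻¹ with hy
  have hy0 : 0 < y := by positivity
  have hy1 : y ≤ 1 := inv_le_one_of_one_le₀ (by linarith)
  have hCy : C * y ≤ 1 := by
    rw [hy, ← div_eq_mul_inv, div_le_one (by linarith)]; linarith
  refine ⟨y, hy0, ∑ b ∈ Finset.range (d + 1), f 1 b, fun N => ?_⟩
  induction N using Nat.strong_induction_on with
  | _ N ih =>
    rcases lt_or_ge N (d + 1) with hN | hN
    · calc f 1 N * y ^ N ≤ f 1 N * 1 :=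
            mul_le_mul_of_nonneg_left (pow_le_one₀ hy0.le hy1) (h.f_nonneg _ _)
        _ ≤ _ := by
            rw [mul_one]
            exact Finset.single_le_sum (f := fun b => f 1 b) (fun b _ => h.f_nonneg _ _)
              (Finset.mem_range.2 hN)
    · obtain ⟨M, rfl⟩ : ∃ M, N = M + d := ⟨N - d, by omega⟩
      refine le_trans ?_ (ih M (by omega))
      have hyd : y ^ d ≤ y := by
        simpa using pow_le_pow_of_le_one hy0.le hy1 hd
      calc f 1 (M + d) * y ^ (M + d) ≤ (C * f 1 M) * y ^ (M + d) := by
            gcongr; exact hup M (by omega)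
        _ = (C * y ^ d) * (f 1 M * y ^ M) := by ring
        _ ≤ 1 * (f 1 M * y ^ M) := by
            refine mul_le_mul_of_nonneg_right ?_ (mul_nonneg (h.f_nonneg _ _) (by positivity))
            exact (mul_le_mul_of_nonneg_left hyd hC.le).trans hCy
        _ = _ := one_mul _

end Model

/-! ### Three-term recurrences with complex characteristic roots -/

/-- Solution of the forced recurrence of Chebyshev type. -/
theorem chebyshev_recurrence_solution {v G : ℕ → ℝ} {φ : ℝ} (h0 : v 0 = 0)
    (h : ∀ k, v (k + 2) - 2 * Real.cos φ * v (k + 1) + v k = G k) (n : ℕ) :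
    v (n + 1) * Real.sin φ = v 1 * Real.sin ((n + 1 : ℕ) * φ) +
      ∑ k ∈ Finset.range n, Real.sin (((n : ℝ) - k) * φ) * G k := by
  have trig : ∀ x : ℝ, Real.sin (x + 2 * φ) = 2 * Real.cos φ * Real.sin (x + φ) - Real.sin x := by
    intro x
    rw [two_mul, Real.sin_add, Real.sin_add, Real.cos_add, Real.sin_add]
    linear_combination -Real.sin x * Real.sin_sq_add_cos_sq φ
  induction n using Nat.strong_induction_on with
  | _ n ih =>
    match n with
    | 0 => simp
    | 1 =>
      have e := h 0
      simp only [h0, zero_add] at e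
      have t := trig 0
      simp only [zero_add, Real.sin_zero] at t
      simp only [Finset.sum_range_one]
      push_cast
      rw [t, show ((1 : ℝ) - 0) * φ = φ by ring, ← e]
      ring
    | n + 2 =>
      have e := h (n + 1)
      have i1 := ih (n + 1) (by omega)
      have i0 := ih n (by omega)
      rw [Finset.sum_range_succ, Finset.sum_range_succ]
      rw [Finset.sum_range_succ] at i1
      have t1 := trig ((n + 1 : ℕ) * φ)
      have st : ∑ k ∈ Finset.range n, Real.sin ((((n + 2 : ℕ) : ℝ) - k) * φ) * G k =
          2 * Real.cos φ * ∑ k ∈ Finset.range n, Real.sin ((((n + 1 : ℕ) : ℝ) - k) * φ) * G k -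
          ∑ k ∈ Finset.range n, Real.sin (((n : ℝ) - k) * φ) * G k := by
        rw [Finset.mul_sum, ← Finset.sum_sub_distrib]
        refine Finset.sum_congr rfl fun k _ => ?_
        have := trig (((n : ℝ) - k) * φ)
        push_cast
        rw [show ((n : ℝ) + 2 - k) * φ = ((n : ℝ) - k) * φ + 2 * φ by ring, this,
          show ((n : ℝ) + 1 - k) * φ = ((n : ℝ) - k) * φ + φ by ring]
        ring
      have t2 := trig 0
      simp only [zero_add, Real.sin_zero, sub_zero] at t2
      rw [st]
      push_cast at *
      rw [show ((n : ℝ) + 2 + 1) * φ = (n + 1) * φ + 2 * φ by ring, t1,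
        show ((n : ℝ) + 2 - n) * φ = 2 * φ by ring, t2,
        show ((n : ℝ) + 2 - (n + 1)) * φ = φ by ring]
      rw [show ((n : ℝ) + 1 - n) * φ = φ by ring,
        show ((n : ℝ) + 1 + 1) * φ = (n + 1) * φ + φ by ring] at i1
      linear_combination Real.sin φ * e + 2 * Real.cos φ * i1 - i0

/-- A non-trivial solution of a linear recurrence without positive characteristic root is
not everywhere nonnegative. -/
theorem not_nonneg_of_oscillating {u : ℕ → ℝ} {A B C : ℝ} (hA : 0 < A) (hC : 0 < C)
    (hpos : ∀ t : ℝ, 0 < t → B < A * t + C / t) (h0 : u 0 = 0) (h1 : u 1 = 1)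
    (h : ∀ k, A * u (k + 2) - B * u (k + 1) + C * u k = 0) : ¬ ∀ k, 0 ≤ u k := by
  intro hu
  have e0 := h 0
  have e1 := h 1
  simp only [zero_add, h0, h1] at e0 e1
  have hB : 0 < B := by
    have := mul_nonneg hA.le (hu 3)
    have h2 : 0 < B * u 2 := by linarith
    exact pos_of_mul_pos_left h2 (hu 2)
  set m := √(A * C) with hm
  have hm0 : 0 < m := Real.sqrt_pos.2 (by positivity)
  have hmm : m * m = A * C := Real.mul_self_sqrt (by positivity)
  -- `m / A` minimises `A t + C / t`, with minimum `2 m`: the discriminant is negative.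
  have hBm : B < 2 * m := by
    have := hpos (m / A) (by positivity)
    have e : A * (m / A) + C / (m / A) = 2 * m := by
      field_simp
      linarith
    linarith
  set φ := Real.arccos (B / (2 * m)) with hφ
  have hcos : Real.cos φ = B / (2 * m) := Real.cos_arccos
    (by have : 0 < B / (2 * m) := by positivity
        linarith) (by rw [div_le_one (by positivity)]; exact hBm.le)
  have hφ0 : 0 < φ := Real.arccos_pos.2 (by rw [div_lt_one (by positivity)]; exact hBm)
  have hφ1 : φ < Real.pi := by
    have : φ ≤ Real.pi / 2 := Real.arccos_le_pi_div_two.2 (by positivity)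
    linarith [Real.pi_pos]
  have key := chebyshev_recurrence_solution (v := fun k => u k * (A / m) ^ k) (G := fun _ => 0)
    (φ := φ) (by simp [h0]) (by
      intro k
      have e : A * (u (k + 2) * (A / m) ^ (k + 2) -
          2 * Real.cos φ * (u (k + 1) * (A / m) ^ (k + 1)) + u k * (A / m) ^ k) =
          (A / m) ^ (k + 2) * (A * u (k + 2) - B * u (k + 1) + C * u k) := by
        rw [hcos, pow_succ, pow_succ]
        field_simp
        linear_combination u k * hmm
      rw [h, mul_zero] at e
      exact (mul_eq_zero.1 e).resolve_left hA.ne')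
  simp only [mul_zero, Finset.sum_const_zero, add_zero, h1, one_mul, pow_one] at key
  -- The first multiple of `φ` beyond `π` is at most `π + φ < 2π`, so its sine is negative.
  have hfl := Nat.floor_le (a := Real.pi / φ) (by positivity)
  have hfl' := Nat.lt_floor_add_one (Real.pi / φ)
  rw [le_div_iff₀ hφ0] at hfl
  rw [div_lt_iff₀ hφ0] at hfl'
  have hneg : Real.sin ((⌊Real.pi / φ⌋₊ + 1 : ℕ) * φ) < 0 := by
    have : Real.sin ((⌊Real.pi / φ⌋₊ + 1 : ℕ) * φ) =
        Real.sin ((⌊Real.pi / φ⌋₊ + 1 : ℕ) * φ - 2 * Real.pi) := by simp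
    rw [this]
    refine Real.sin_neg_of_neg_of_neg_pi_lt ?_ ?_ <;> push_cast <;> linarith
  have hl := key ⌊Real.pi / φ⌋₊
  have hs : 0 ≤ Real.sin φ := Real.sin_nonneg_of_nonneg_of_le_pi hφ0.le hφ1.le
  have : 0 ≤ u (⌊Real.pi / φ⌋₊ + 1) * (A / m) ^ (⌊Real.pi / φ⌋₊ + 1) * Real.sin φ :=
    mul_nonneg (mul_nonneg (hu _) (by positivity)) hs
  rw [hl] at this
  nlinarith [div_pos hA hm0]

/-! ### Positivity of the kernel under zero drift -/

theorem sq_div_six_le_exp_sub {t : ℝ} (ht : -2 ≤ t) : t ^ 2 / 6 ≤ Real.exp t - 1 - t := by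
  have h := Real.add_one_le_exp (t / 2)
  have h2 : (t / 2 + 1) ^ 2 ≤ Real.exp (t / 2) ^ 2 := pow_le_pow_left₀ (by linarith) h 2
  rw [← Real.exp_nat_mul, show ((2 : ℕ) : ℝ) * (t / 2) = t by push_cast; ring] at h2
  nlinarith [sq_nonneg t]

/-- The covariance form of the walk. -/
def covForm (p : ℤ → ℤ → ℝ) (α s : ℝ) : ℝ :=
  p 1 1 * (α + s) ^ 2 + p 1 0 * α ^ 2 + p 1 (-1) * (α - s) ^ 2 + p 0 (-1) * (-s) ^ 2 +
    p (-1) (-1) * (-α - s) ^ 2 + p (-1) 0 * (-α) ^ 2 + p (-1) 1 * (-α + s) ^ 2 + p 0 1 * s ^ 2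

namespace Model

variable {p : ℤ → ℤ → ℝ} {f : ℕ → ℕ → ℝ}

/-- By (H2) the jumps span the plane, so the determinant is positive. The constant `δ` is
determinant over trace, a lower bound for the smaller eigenvalue. -/
theorem exists_le_covForm (h : Model p f) :
    ∃ δ : ℝ, 0 < δ ∧ ∀ α s : ℝ, δ * (α ^ 2 + s ^ 2) ≤ covForm p α s := by
  obtain ⟨a1, a2, a3, a4, a5, a6, a7, a8⟩ := h.all_nonneg
  obtain ⟨w1, w2, w3, w4, w5, w6⟩ := h.windows
  set A := p 1 1 + p 1 0 + p 1 (-1) + p (-1) (-1) + p (-1) 0 + p (-1) 1 with hA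
  set D := p 1 1 + p 0 1 + p (-1) 1 + p (-1) (-1) + p 0 (-1) + p 1 (-1) with hD
  set B := p 1 1 + p (-1) (-1) - p 1 (-1) - p (-1) 1 with hB
  have hA0 : 0 < A := by linarith
  have hD0 : 0 < D := by linarith
  have hdet : 0 < A * D - B ^ 2 := by
    have e : A * D - B ^ 2 = 4 * ((p 1 1 + p (-1) (-1)) * (p 1 (-1) + p (-1) 1)) +
        ((p 1 1 + p (-1) (-1)) + (p 1 (-1) + p (-1) 1)) *
          ((p 1 0 + p (-1) 0) + (p 0 1 + p 0 (-1))) +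
        (p 1 0 + p (-1) 0) * (p 0 1 + p 0 (-1)) := by rw [hA, hD, hB]; ring
    rw [e]
    have u0 : 0 ≤ p 1 1 + p (-1) (-1) := by linarith
    have v0 : 0 ≤ p 1 (-1) + p (-1) 1 := by linarith
    have x0 : 0 ≤ p 1 0 + p (-1) 0 := by linarith
    have y0 : 0 ≤ p 0 1 + p 0 (-1) := by linarith
    rcases u0.lt_or_eq with hu | hu <;> rcases v0.lt_or_eq with hv | hv
    · positivity
    · have : 0 < (p 1 0 + p (-1) 0) + (p 0 1 + p 0 (-1)) := by linarith
      positivity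
    · have : 0 < (p 1 0 + p (-1) 0) + (p 0 1 + p 0 (-1)) := by linarith
      positivity
    · have hx : 0 < p 1 0 + p (-1) 0 := by linarith
      have hy : 0 < p 0 1 + p 0 (-1) := by linarith
      positivity
  refine ⟨(A * D - B ^ 2) / (A + D), by positivity, fun α s => ?_⟩
  rw [div_mul_eq_mul_div, div_le_iff₀ (by positivity)]
  have e : covForm p α s = A * α ^ 2 + 2 * B * α * s + D * s ^ 2 := by
    simp only [covForm, hA, hB, hD]; ring
  rw [e]
  nlinarith [sq_nonneg (A * α + B * s), sq_nonneg (B * α + D * s)]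

/-- In exponential coordinates the kernel is an average of `exp x - 1 - x` over `x = iα + js`: total
mass one supplies the `-1`, zero drift the `-x`. -/
theorem kernel_eq (h : Model p f) (α s : ℝ) :
    colWeight p 1 (Real.exp (-s)) * Real.exp α + colWeight p (-1) (Real.exp (-s)) / Real.exp α -
      (1 - colWeight p 0 (Real.exp (-s))) =
    p 1 1 * (Real.exp (α + s) - 1 - (α + s)) + p 1 0 * (Real.exp α - 1 - α) +
    p 1 (-1) * (Real.exp (α - s) - 1 - (α - s)) + p 0 (-1) * (Real.exp (-s) - 1 - (-s)) +
    p (-1) (-1) * (Real.exp (-α - s) - 1 - (-α - s)) + p (-1) 0 * (Real.exp (-α) - 1 - (-α)) +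
    p (-1) 1 * (Real.exp (-α + s) - 1 - (-α + s)) + p 0 1 * (Real.exp s - 1 - s) := by
  have d1 := h.drift_fst
  have d2 := h.drift_snd
  have s1 := h.sum_eq_one
  simp only [colWeight, h.step.zero_zero, sub_eq_add_neg, Real.exp_add, Real.exp_neg]
  have := Real.exp_pos α
  have := Real.exp_pos s
  field_simp
  linear_combination (Real.exp α * Real.exp s) * s1 + α * Real.exp α * Real.exp s * d1 +
    s * Real.exp α * Real.exp s * d2

/-- The terms of `kernel_eq` are nonnegative. Were their sum not positive, every jump of positive
weight would have `iα + js = 0` and the covariance form would vanish. -/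
theorem one_lt_kernel (h : Model p f) {y t : ℝ} (hy : 0 < y) (hy1 : y < 1) (ht : 0 < t) :
    1 - colWeight p 0 y < colWeight p 1 y * t + colWeight p (-1) y / t := by
  obtain ⟨a1, a2, a3, a4, a5, a6, a7, a8⟩ := h.all_nonneg
  obtain ⟨δ, hδ, hQ⟩ := h.exists_le_covForm
  obtain ⟨α, rfl⟩ : ∃ α, t = Real.exp α := ⟨Real.log t, (Real.exp_log ht).symm⟩
  obtain ⟨s, rfl⟩ : ∃ s, y = Real.exp (-s) := ⟨-Real.log y, by rw [neg_neg, Real.exp_log hy]⟩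
  have k := h.kernel_eq α s
  have hs0 : 0 < s := by linarith [Real.exp_lt_one_iff.1 hy1]
  have q := hQ α s
  have hq : 0 < covForm p α s := lt_of_lt_of_le (by positivity) q
  have g0 : ∀ x : ℝ, 0 ≤ Real.exp x - 1 - x := fun x => by linarith [Real.add_one_le_exp x]
  have g1 : ∀ w x : ℝ, 0 ≤ w → w * (Real.exp x - 1 - x) ≤ 0 → w * x ^ 2 = 0 := by
    intro w x hw hle
    rcases eq_or_ne x 0 with rfl | hx
    · simp
    · have : 0 < Real.exp x - 1 - x := by linarith [Real.add_one_lt_exp hx]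
      have : w = 0 := by nlinarith
      simp [this]
  have n1 := mul_nonneg a1 (g0 (α + s))
  have n2 := mul_nonneg a2 (g0 α)
  have n3 := mul_nonneg a3 (g0 (α - s))
  have n4 := mul_nonneg a4 (g0 (-s))
  have n5 := mul_nonneg a5 (g0 (-α - s))
  have n6 := mul_nonneg a6 (g0 (-α))
  have n7 := mul_nonneg a7 (g0 (-α + s))
  have n8 := mul_nonneg a8 (g0 s)
  by_contra! hc
  refine hq.ne' ?_
  rw [covForm, g1 _ _ a1 (by linarith), g1 _ _ a2 (by linarith), g1 _ _ a3 (by linarith),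
    g1 _ _ a4 (by linarith), g1 _ _ a5 (by linarith), g1 _ _ a6 (by linarith),
    g1 _ _ a7 (by linarith), g1 _ _ a8 (by linarith)]
  simp

/-- Quantitative positivity near the critical point, used to compare `log ρ` with the angle `φ`. -/
theorem covForm_le_kernel (h : Model p f) {α s : ℝ} (hα : |α| ≤ 1) (hs : |s| ≤ 1) :
    covForm p α s / 6 ≤ colWeight p 1 (Real.exp (-s)) * Real.exp α +
      colWeight p (-1) (Real.exp (-s)) / Real.exp α - (1 - colWeight p 0 (Real.exp (-s))) := by
  obtain ⟨a1, a2, a3, a4, a5, a6, a7, a8⟩ := h.all_nonneg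
  rw [h.kernel_eq]
  rw [abs_le] at hα hs
  have g : ∀ w x : ℝ, 0 ≤ w → -2 ≤ x → w * x ^ 2 / 6 ≤ w * (Real.exp x - 1 - x) := by
    intro w x hw hx
    rw [mul_div_assoc]
    exact mul_le_mul_of_nonneg_left (sq_div_six_le_exp_sub hx) hw
  have n1 := g _ (α + s) a1 (by linarith)
  have n2 := g _ α a2 (by linarith)
  have n3 := g _ (α - s) a3 (by linarith)
  have n4 := g _ (-s) a4 (by linarith)
  have n5 := g _ (-α - s) a5 (by linarith)
  have n6 := g _ (-α) a6 (by linarith)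
  have n7 := g _ (-α + s) a7 (by linarith)
  have n8 := g _ s a8 (by linarith)
  simp only [covForm]
  linarith

theorem colWeight_one_pos (h : Model p f) {y : ℝ} (hy : 0 < y) : 0 < colWeight p 1 y := by
  obtain ⟨a1, a2, a3, -⟩ := h.all_nonneg
  have w := h.windows.1
  have t1 : 0 ≤ p 1 1 / y := by positivity
  have t3 : 0 ≤ p 1 (-1) * y := by positivity
  refine lt_of_le_of_ne (by unfold colWeight; positivity) fun he => ?_
  unfold colWeight at he
  have e1 : p 1 1 / y = 0 := by linarith
  have e3 : p 1 (-1) * y = 0 := by linarith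
  have e1' : p 1 1 = 0 := by simpa [hy.ne'] using e1
  have e3' : p 1 (-1) = 0 := by simpa [hy.ne'] using e3
  linarith

theorem colWeight_neg_one_pos (h : Model p f) {y : ℝ} (hy : 0 < y) : 0 < colWeight p (-1) y := by
  obtain ⟨-, -, -, -, a5, a6, a7, -⟩ := h.all_nonneg
  have w := h.windows.2.2.1
  have t1 : 0 ≤ p (-1) 1 / y := by positivity
  have t3 : 0 ≤ p (-1) (-1) * y := by positivity
  refine lt_of_le_of_ne (by unfold colWeight; positivity) fun he => ?_
  unfold colWeight at he
  have e1 : p (-1) 1 / y = 0 := by linarith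
  have e3 : p (-1) (-1) * y = 0 := by linarith
  have e1' : p (-1) 1 = 0 := by simpa [hy.ne'] using e1
  have e3' : p (-1) (-1) = 0 := by simpa [hy.ne'] using e3
  linarith

end Model

/-! ### Truncation levels with light windows -/

open Filter Topology

/-- Just beyond the radius of convergence there are large partial sums that are not dominated by
their last terms. -/
theorem exists_partial_sum_window {g : ℕ → ℝ} (hg : ∀ n, 0 ≤ g n) {R : ℝ} (hR : 0 < R)
    (hlt : ∀ z, 0 < z → z < R → ∃ C, ∀ n, g n * z ^ n ≤ C)
    (hgt : ∀ y, R < y → ¬ ∃ C, ∀ n, g n * y ^ n ≤ C) {ε : ℝ} (hε : 0 < ε) (L : ℕ) :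
    ∃ y, R < y ∧ y < R + ε ∧ ∃ N, L ≤ N ∧ ε⁻¹ ≤ ∑ b ∈ Finset.range N, g (b + 1) * y ^ (b + 1) ∧
      ∑ b ∈ Finset.Ico (N - L) (N + L), g (b + 1) * y ^ (b + 1) ≤
        ε * ∑ b ∈ Finset.range N, g (b + 1) * y ^ (b + 1) := by
  -- With `y = R t`, the bound at `R / t` makes terms grow at most like `(t ^ 2) ^ n`. Over `2 L`
  -- steps this factor is below `1 + ε / 2`, whereas heavy windows everywhere would force growth by
  -- `1 + ε` (`hgrow`).
  obtain ⟨t, ht1, htR, htL⟩ : ∃ t : ℝ, 1 < t ∧ R * t < R + ε ∧ (t ^ 2) ^ (2 * L) < 1 + ε / 2 := by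
    have c1 : Tendsto (fun t : ℝ => R * t) (𝓝[>] 1) (𝓝 (R * 1)) :=
      ((continuous_const.mul continuous_id).tendsto 1).mono_left nhdsWithin_le_nhds
    have c2 : Tendsto (fun t : ℝ => (t ^ 2) ^ (2 * L)) (𝓝[>] 1) (𝓝 (((1 : ℝ) ^ 2) ^ (2 * L))) :=
      (((continuous_id.pow 2).pow (2 * L)).tendsto 1).mono_left nhdsWithin_le_nhds
    have e1 := c1.eventually_lt_const (u := R + ε) (by linarith)
    have e2 := c2.eventually_lt_const (u := 1 + ε / 2) (by simp; linarith)
    obtain ⟨t, h1, h2, h3⟩ := (e1.and (e2.and self_mem_nhdsWithin)).exists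
    exact ⟨t, h3, h1, h2⟩
  have ht0 : 0 < t := by linarith
  have hz0 : 0 < R / t := by positivity
  obtain ⟨C, hC⟩ := hlt (R / t) hz0 (div_lt_self hR ht1)
  have hC0 : 0 ≤ C := (mul_nonneg (hg 0) (by positivity)).trans (hC 0)
  have hy0 : 0 < R * t := by positivity
  have hRy : R < R * t := lt_mul_of_one_lt_right hR ht1
  have hun := hgt _ hRy
  refine ⟨R * t, hRy, htR, ?_⟩
  set s : ℕ → ℝ := fun N => ∑ b ∈ Finset.range N, g (b + 1) * (R * t) ^ (b + 1) with hs
  have hterm : ∀ n, 0 ≤ g n * (R * t) ^ n := fun n => mul_nonneg (hg n) (by positivity)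
  have hmono : Monotone s := fun a b hab => Finset.sum_le_sum_of_subset_of_nonneg
    (Finset.range_mono hab) fun n _ _ => hterm _
  have hs0 : ∀ N, 0 ≤ s N := fun N => Finset.sum_nonneg fun _ _ => hterm _
  have hunb : ∀ B, ∃ N, B < s N := by
    intro B
    by_contra! hB
    refine hun ⟨max B (g 0), fun n => ?_⟩
    rcases n with _ | n
    · simp
    · refine le_trans ?_ ((hB (n + 1)).trans (le_max_left _ _))
      exact Finset.single_le_sum (f := fun b => g (b + 1) * (R * t) ^ (b + 1))
        (fun b _ => hterm _) (Finset.self_mem_range_succ n)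
  have hbound : ∀ N, s N ≤ N * (C * (t ^ 2) ^ N) := by
    intro N
    have : ∀ b ∈ Finset.range N, g (b + 1) * (R * t) ^ (b + 1) ≤ C * (t ^ 2) ^ N := by
      intro b hb
      have e : R * t = (R / t) * t ^ 2 := by field_simp
      rw [e, mul_pow, ← mul_assoc]
      refine mul_le_mul (hC _) (pow_le_pow_right₀ (one_le_pow₀ ht1.le) ?_) (by positivity) hC0
      exact Finset.mem_range.1 hb
    simpa using Finset.sum_le_card_nsmul _ _ _ this
  by_contra! hcon
  have hgrow : ∀ N, ε⁻¹ ≤ s N → (1 + ε) * s N ≤ s (N + 2 * L) := by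
    intro N hN
    have h1 := hcon (N + L) (by omega) (hN.trans (hmono (by omega)))
    rw [Finset.sum_Ico_eq_sub _ (by omega)] at h1
    have e1 : N + L + L = N + 2 * L := by ring
    rw [Nat.add_sub_cancel, e1] at h1
    have h2 : s N ≤ s (N + L) := hmono (by omega)
    have h3 : ε * s (N + L) < s (N + 2 * L) - s N := h1
    nlinarith
  obtain ⟨N0, hN0⟩ := hunb ε⁻¹
  have hpow : ∀ k : ℕ, (1 + ε) ^ k * s N0 ≤ s (N0 + 2 * L * k) := by
    intro k
    induction k with
    | zero => simp
    | succ k ih =>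
      have := hgrow (N0 + 2 * L * k) (hN0.le.trans (hmono (by omega)))
      calc (1 + ε) ^ (k + 1) * s N0 = (1 + ε) * ((1 + ε) ^ k * s N0) := by ring
        _ ≤ (1 + ε) * s (N0 + 2 * L * k) := by gcongr
        _ ≤ _ := this
        _ = _ := by congr 1; ring
  set q : ℝ := (1 + ε / 2) / (1 + ε) with hq
  have hq0 : 0 ≤ q := by positivity
  have hq1 : q < 1 := by rw [hq, div_lt_one (by positivity)]; linarith
  have hle : ∀ k : ℕ, s N0 ≤ (C * (t ^ 2) ^ N0) * (N0 * q ^ k + 2 * L * (k * q ^ k)) := by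
    intro k
    have h1 := (hpow k).trans (hbound _)
    have h2 : (t ^ 2) ^ (N0 + 2 * L * k) ≤ (t ^ 2) ^ N0 * (1 + ε / 2) ^ k := by
      rw [pow_add, pow_mul (t ^ 2) (2 * L) k]
      gcongr
    have h3 : (1 + ε) ^ k * s N0 ≤
        ((N0 + 2 * L * k : ℕ) : ℝ) * (C * ((t ^ 2) ^ N0 * (1 + ε / 2) ^ k)) :=
      h1.trans (by gcongr)
    rw [mul_comm, ← le_div_iff₀ (by positivity)] at h3
    refine h3.trans_eq ?_
    rw [hq, div_pow]
    push_cast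
    field_simp
  have hlim : Tendsto (fun k : ℕ => (C * (t ^ 2) ^ N0) * (N0 * q ^ k + 2 * L * (k * q ^ k))) atTop
      (𝓝 ((C * (t ^ 2) ^ N0) * (N0 * 0 + 2 * L * 0))) :=
    (((tendsto_pow_atTop_nhds_zero_of_lt_one hq0 hq1).const_mul _).add
      ((tendsto_self_mul_const_pow_of_lt_one hq0 hq1).const_mul _)).const_mul _
  have := ge_of_tendsto' hlim hle
  simp only [mul_zero, add_zero] at this
  have : 0 < ε⁻¹ := by positivity
  linarith

/-! ### Radius of convergence at least one -/

namespace Model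

variable {p : ℤ → ℤ → ℝ} {f : ℕ → ℕ → ℝ}

theorem p_le_one (h : Model p f) {i j : ℤ} (hi : i ∈ Finset.Icc (-1 : ℤ) 1)
    (hj : j ∈ Finset.Icc (-1 : ℤ) 1) : p i j ≤ 1 := by
  rw [← h.step.sum_eq_one]
  exact (Finset.single_le_sum (f := fun j => p i j) (fun j hj => h.p_nonneg hi hj) hj).trans
    (Finset.single_le_sum (f := fun i => ∑ j ∈ Finset.Icc (-1 : ℤ) 1, p i j)
      (fun i hi => Finset.sum_nonneg fun j hj => h.p_nonneg hi hj) hi)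

theorem abs_topTerm_le (h : Model p f) {y : ℝ} (hy : 0 ≤ y) {i : ℤ}
    (hi : i ∈ Finset.Icc (-1 : ℤ) 1) (a N : ℕ) :
    |topTerm p f y N i a| ≤ f a (N + 1) * y ^ N + f a N * y ^ (N + 1) := by
  have n1 : 0 ≤ f a (N + 1) * y ^ N := mul_nonneg (h.f_nonneg _ _) (by positivity)
  have n2 : 0 ≤ f a N * y ^ (N + 1) := mul_nonneg (h.f_nonneg _ _) (by positivity)
  have p1 := h.p_nonneg hi (j := 1) (by decide)
  have p2 := h.p_nonneg hi (j := -1) (by decide)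
  have q1 := h.p_le_one hi (j := 1) (by decide)
  have q2 := h.p_le_one hi (j := -1) (by decide)
  have m1 := mul_le_of_le_one_left n1 q1
  have m2 := mul_le_of_le_one_left n2 q2
  have k1 := mul_nonneg p1 n1
  have k2 := mul_nonneg p2 n2
  rw [topTerm, mul_assoc, mul_assoc, abs_le]
  constructor <;> linarith

/-- The terms near the truncation level of any column are dominated by those of the first one. -/
theorem edge_le_window (h : Model p f) {R : ℝ} (hR : 0 < R) (a : ℕ) :
    ∃ C : ℝ, 0 ≤ C ∧ ∀ y, R ≤ y → y ≤ 1 → ∀ L N : ℕ, a + 1 ≤ L → L ≤ N →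
      f a (N + 1) * y ^ N + f a N * y ^ (N + 1) ≤
        C * ∑ b ∈ Finset.Ico (N - L) (N + L), f 1 (b + 1) * y ^ (b + 1) := by
  rcases a with _ | k
  · exact ⟨0, le_rfl, fun y _ _ L N _ _ => by simp [h.f_zero_left]⟩
  obtain ⟨C, hC, hb⟩ := h.f_le_first_column k
  refine ⟨2 * (C / R ^ (k + 1)), by positivity, fun y hRy hy1 L N hL hN => ?_⟩
  have hy0 : 0 < y := hR.trans_le hRy
  set W := ∑ b ∈ Finset.Ico (N - L) (N + L), f 1 (b + 1) * y ^ (b + 1) with hW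
  have main : ∀ M E : ℕ, k + 1 ≤ M → N ≤ M → M ≤ N + 1 → N ≤ E → M ≤ E + 1 →
      f (k + 1) M * y ^ E ≤ (C / R ^ (k + 1)) * W := by
    intro M E hM hM1 hM2 hE1 hE2
    obtain ⟨b, hb1, hb2, hb3, hfb⟩ := hb M hM
    -- The height `b` exceeds `E` by at most `k + 1`; each extra factor `y` costs at most `1 / R`.
    have e1 : R ^ (k + 1) * y ^ E ≤ y ^ b := by
      calc R ^ (k + 1) * y ^ E ≤ y ^ (k + 1) * y ^ E := by gcongr
        _ = y ^ (k + 1 + E) := (pow_add _ _ _).symm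
        _ ≤ y ^ b := pow_le_pow_of_le_one hy0.le hy1 (by omega)
    have e2 : f 1 b * y ^ b ≤ W := by
      obtain ⟨c, rfl⟩ : ∃ c, b = c + 1 := ⟨b - 1, by omega⟩
      exact Finset.single_le_sum (f := fun b => f 1 (b + 1) * y ^ (b + 1))
        (fun b _ => mul_nonneg (h.f_nonneg _ _) (by positivity))
        (Finset.mem_Ico.2 (by omega))
    rw [div_mul_eq_mul_div, le_div_iff₀ (by positivity)]
    calc f (k + 1) M * y ^ E * R ^ (k + 1) ≤ C * f 1 b * y ^ E * R ^ (k + 1) := by gcongr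
      _ = C * (f 1 b * (R ^ (k + 1) * y ^ E)) := by ring
      _ ≤ C * (f 1 b * y ^ b) := by
        gcongr
        exact h.f_nonneg _ _
      _ ≤ C * W := by gcongr
  have m1 := main (N + 1) N (by omega) (by omega) le_rfl le_rfl le_rfl
  have m2 := main N (N + 1) (by omega) le_rfl (by omega) (by omega) (by omega)
  linarith

theorem abs_topError_le_window (h : Model p f) {R : ℝ} (hR : 0 < R) (a : ℕ) :
    ∃ C : ℝ, 0 ≤ C ∧ ∀ y, R ≤ y → y ≤ 1 → ∀ L N : ℕ, a + 3 ≤ L → L ≤ N →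
      |topError p f y N a| ≤
        C * ∑ b ∈ Finset.Ico (N - L) (N + L), f 1 (b + 1) * y ^ (b + 1) := by
  obtain ⟨C1, h1, b1⟩ := h.edge_le_window hR (a + 2)
  obtain ⟨C2, h2, b2⟩ := h.edge_le_window hR (a + 1)
  obtain ⟨C3, h3, b3⟩ := h.edge_le_window hR a
  refine ⟨C1 + C2 + C3, by positivity, fun y hRy hy1 L N hL hN => ?_⟩
  have hy0 : 0 ≤ y := hR.le.trans hRy
  have t1 := (h.abs_topTerm_le hy0 (i := 1) (by decide) (a + 2) N).trans
    (b1 y hRy hy1 L N (by omega) hN)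
  have t2 := (h.abs_topTerm_le hy0 (i := 0) (by decide) (a + 1) N).trans
    (b2 y hRy hy1 L N (by omega) hN)
  have t3 := (h.abs_topTerm_le hy0 (i := -1) (by decide) a N).trans
    (b3 y hRy hy1 L N (by omega) hN)
  rw [topError, add_mul, add_mul]
  exact (abs_add_three _ _ _).trans (by linarith)

theorem continuousAt_colWeight (p : ℤ → ℤ → ℝ) (i : ℤ) {y : ℝ} (hy : y ≠ 0) :
    ContinuousAt (colWeight p i) y := by
  unfold colWeight
  exact ((continuousAt_const.div continuousAt_id hy).add continuousAt_const).add
    (continuousAt_const.mul continuousAt_id)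

/-- The first column grows subexponentially. -/
theorem first_column_bounded (h : Model p f) {y : ℝ} (hy0 : 0 < y) (hy1 : y < 1) :
    ∃ C : ℝ, ∀ N, f 1 N * y ^ N ≤ C := by
  by_contra hy
  set S : Set ℝ := {z | 0 < z ∧ ∃ C : ℝ, ∀ N, f 1 N * z ^ N ≤ C} with hS
  have hdown : ∀ z w, 0 < z → z ≤ w → w ∈ S → z ∈ S := by
    rintro z w hz hzw ⟨-, C, hC⟩
    refine ⟨hz, C, fun N => le_trans ?_ (hC N)⟩
    gcongr
    exact h.f_nonneg _ _
  have hub : ∀ z ∈ S, z ≤ y := by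
    intro z hz
    by_contra! hlt
    exact hy (hdown y z hy0 hlt.le hz).2
  have hbdd : BddAbove S := ⟨y, hub⟩
  obtain ⟨y0, hy00, hy0S⟩ := h.exists_geometric_bound
  set R := sSup S with hRdef
  have hR0 : 0 < R := hy00.trans_le (le_csSup hbdd (show y0 ∈ S from ⟨hy00, hy0S⟩))
  have hR1 : R < 1 := (csSup_le (show S.Nonempty from ⟨y0, hy00, hy0S⟩) hub).trans_lt hy1
  have hlt : ∀ z, 0 < z → z < R → ∃ C, ∀ n, f 1 n * z ^ n ≤ C := by
    intro z hz hzR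
    obtain ⟨w, hw, hzw⟩ := exists_lt_of_lt_csSup (show S.Nonempty from ⟨y0, hy00, hy0S⟩) hzR
    exact (hdown z w hz hzw.le hw).2
  have hgt : ∀ z, R < z → ¬ ∃ C, ∀ n, f 1 n * z ^ n ≤ C := fun z hz hC =>
    (le_csSup hbdd (show z ∈ S from ⟨hR0.trans hz, hC⟩)).not_gt hz
  -- The factor `1 - R` keeps `Y j ≤ 1`. The window half-width is `j` itself, so it eventually
  -- exceeds the `a + 3` required by each fixed column `a`.
  have hε0 : ∀ j : ℕ, 0 < (1 - R) * (1 / ((j : ℝ) + 1)) := fun j =>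
    mul_pos (by linarith) (by positivity)
  choose Y hRY hYε N hLN hbig hwin using fun j : ℕ =>
    exists_partial_sum_window (h.f_nonneg 1) hR0 hlt hgt (hε0 j) j
  have hεlim : Tendsto (fun j : ℕ => (1 - R) * (1 / ((j : ℝ) + 1))) atTop (𝓝 0) := by
    simpa using tendsto_one_div_add_atTop_nhds_zero_nat.const_mul (1 - R)
  have hY1 : ∀ j, Y j ≤ 1 := by
    intro j
    have : (1 - R) * (1 / ((j : ℝ) + 1)) ≤ (1 - R) * 1 := by
      refine mul_le_mul_of_nonneg_left ?_ (by linarith)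
      rw [div_le_one (by positivity)]
      linarith [(Nat.cast_nonneg j : (0 : ℝ) ≤ j)]
    linarith [hYε j]
  have hY0 : ∀ j, 0 < Y j := fun j => hR0.trans (hRY j)
  have hYlim : Tendsto Y atTop (𝓝 R) := by
    refine tendsto_of_tendsto_of_tendsto_of_le_of_le tendsto_const_nhds
      (h := fun j : ℕ => R + (1 - R) * (1 / ((j : ℝ) + 1))) ?_ (fun j => (hRY j).le)
      (fun j => (hYε j).le)
    simpa using hεlim.const_add R
  have hbig' : ∀ j : ℕ, ((1 - R) * (1 / ((j : ℝ) + 1)))⁻¹ ≤ colSum f (Y j) 1 (N j) := hbig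
  have hS0 : ∀ j, 0 < colSum f (Y j) 1 (N j) := fun j =>
    (inv_pos.2 (hε0 j)).trans_le (hbig' j)
  have hinv : Tendsto (fun j => (colSum f (Y j) 1 (N j))⁻¹) atTop (𝓝 0) := by
    refine squeeze_zero (fun j => (inv_pos.2 (hS0 j)).le) (fun j => ?_) hεlim
    exact inv_le_of_inv_le₀ (hε0 j) (hbig' j)
  have herr : ∀ a, Tendsto (fun j => topError p f (Y j) (N j) a * (colSum f (Y j) 1 (N j))⁻¹)
      atTop (𝓝 0) := by
    intro a
    obtain ⟨C, hC, hCb⟩ := h.abs_topError_le_window hR0 a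
    have : Tendsto (fun j : ℕ => C * ((1 - R) * (1 / ((j : ℝ) + 1)))) atTop (𝓝 0) := by
      simpa using hεlim.const_mul C
    refine squeeze_zero_norm' ?_ this
    filter_upwards [eventually_ge_atTop (a + 3)] with j hj
    rw [Real.norm_eq_abs, abs_mul, abs_of_pos (inv_pos.2 (hS0 j)), ← div_eq_mul_inv,
      div_le_iff₀ (hS0 j)]
    refine (hCb (Y j) (hRY j).le (hY1 j) j (N j) hj (hLN j)).trans ?_
    rw [mul_assoc]
    exact mul_le_mul_of_nonneg_left (hwin j) hC
  have hc : ∀ i, Tendsto (fun j => colWeight p i (Y j)) atTop (𝓝 (colWeight p i R)) := fun i =>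
    (continuousAt_colWeight p i hR0.ne').tendsto.comp hYlim
  set g : ℕ → ℕ → ℝ := fun a j => colSum f (Y j) a (N j) * (colSum f (Y j) 1 (N j))⁻¹ with hg
  have hA := h.colWeight_one_pos hR0
  have hrec : ∀ a j, colWeight p 1 (Y j) * g (a + 2) j =
      (1 - colWeight p 0 (Y j)) * g (a + 1) j - colWeight p (-1) (Y j) * g a j +
        (forcing p f a * (colSum f (Y j) 1 (N j))⁻¹ -
          topError p f (Y j) (N j) a * (colSum f (Y j) 1 (N j))⁻¹) := by
    intro a j
    have := h.colSum_recurrence (hY0 j).ne' a (N j)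
    simp only [hg]
    linear_combination (colSum f (Y j) 1 (N j))⁻¹ * this
  have hrhs : ∀ a u v, Tendsto (g a) atTop (𝓝 u) → Tendsto (g (a + 1)) atTop (𝓝 v) →
      Tendsto (fun j => colWeight p 1 (Y j) * g (a + 2) j) atTop
        (𝓝 ((1 - colWeight p 0 R) * v - colWeight p (-1) R * u)) := by
    intro a u v hu hv
    have e := (((hc 0).const_sub 1).mul hv).sub ((hc (-1)).mul hu)
    have e2 := ((hinv.const_mul (forcing p f a)).sub (herr a))
    rw [mul_zero, sub_zero] at e2
    simpa only [hrec, add_zero] using e.add e2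
  have hex : ∀ a, ∃ u v, Tendsto (g a) atTop (𝓝 u) ∧ Tendsto (g (a + 1)) atTop (𝓝 v) := by
    intro a
    induction a with
    | zero =>
      refine ⟨0, 1, ?_, ?_⟩
      · simp [hg, h.colSum_zero]
      · have : g (0 + 1) = fun _ => 1 := by
          funext j
          simp [hg, (hS0 j).ne']
        rw [this]
        exact tendsto_const_nhds
    | succ a ih =>
      obtain ⟨u, v, hu, hv⟩ := ih
      refine ⟨v, _, hv, ((hrhs a u v hu hv).div (hc 1) hA.ne').congr fun j => ?_⟩
      rw [Pi.div_apply, mul_div_cancel_left₀ _ (h.colWeight_one_pos (hY0 j)).ne']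
  choose u v hu _ using hex
  -- The limits of the normalised columns solve the free recurrence at `R < 1`, with initial values
  -- 0 and 1, and are nonnegative.
  refine not_nonneg_of_oscillating hA (h.colWeight_neg_one_pos hR0)
    (fun t ht => h.one_lt_kernel hR0 hR1 ht) (u := u) ?_ ?_ ?_ ?_
  · refine tendsto_nhds_unique (hu 0) ?_
    simp [hg, h.colSum_zero]
  · refine tendsto_nhds_unique (hu 1) ?_
    have : g 1 = fun _ => 1 := by
      funext j
      simp [hg, (hS0 j).ne']
    rw [this]
    exact tendsto_const_nhds
  · intro k
    have := tendsto_nhds_unique (hrhs k _ _ (hu k) (hu (k + 1))) ((hc 1).mul (hu (k + 2)))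
    linarith
  · intro k
    exact ge_of_tendsto' (hu k) fun j =>
      mul_nonneg (h.colSum_nonneg (hY0 j).le _ _) (inv_pos.2 (hS0 j)).le

/-- Every column grows subexponentially. -/
theorem column_tendsto_zero (h : Model p f) (a : ℕ) {y : ℝ} (hy0 : 0 < y) (hy1 : y < 1) :
    Tendsto (fun N => f a N * y ^ N) atTop (𝓝 0) := by
  rcases a with _ | k
  · simp [h.f_zero_left]
  -- Boundedness at an intermediate `z` leaves the decaying factor `(y / z) ^ N`.
  obtain ⟨z, hyz, hz1⟩ := exists_between hy1
  have hz0 : 0 < z := hy0.trans hyz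
  obtain ⟨B, hB⟩ := h.first_column_bounded hz0 hz1
  obtain ⟨C, hC, hb⟩ := h.f_le_first_column k
  have hlim : Tendsto (fun N : ℕ => (C * B / z ^ k) * (y / z) ^ N) atTop (𝓝 0) := by
    simpa using (tendsto_pow_atTop_nhds_zero_of_lt_one (by positivity)
      ((div_lt_one hz0).2 hyz)).const_mul (C * B / z ^ k)
  refine squeeze_zero' (Eventually.of_forall fun N => mul_nonneg (h.f_nonneg _ _) (by positivity))
    ?_ hlim
  filter_upwards [eventually_ge_atTop (k + 1)] with N hN
  obtain ⟨b, hb1, hb2, hb3, hfb⟩ := hb N hN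
  have e1 : z ^ (N + k) ≤ z ^ b := pow_le_pow_of_le_one hz0.le hz1.le hb3
  have e2 : f (k + 1) N * z ^ (N + k) ≤ C * B := by
    calc f (k + 1) N * z ^ (N + k) ≤ (C * f 1 b) * z ^ b :=
          mul_le_mul hfb e1 (by positivity) (mul_nonneg hC.le (h.f_nonneg _ _))
      _ = C * (f 1 b * z ^ b) := by ring
      _ ≤ C * B := by gcongr; exact hB b
  rw [div_pow, div_mul_div_comm, le_div_iff₀ (by positivity), ← pow_add]
  calc f (k + 1) N * y ^ N * z ^ (k + N) = (f (k + 1) N * z ^ (N + k)) * y ^ N := by ring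
    _ ≤ C * B * y ^ N := by gcongr

end Model

/-! ### Divergence of the bottom row, near the critical point -/

theorem sin_nonpos_of_mem_pi_two_pi {x : ℝ} (h1 : Real.pi ≤ x) (h2 : x ≤ 2 * Real.pi) :
    Real.sin x ≤ 0 := by
  rw [← Real.sin_sub_two_pi]
  exact Real.sin_nonpos_of_nonpos_of_neg_pi_le (by linarith) (by linarith)

/-- A multiple of a small angle that is close to `3π/2`. -/
theorem exists_multiple_near_three_pi_div_two {φ : ℝ} (hφ : 0 < φ) {K : ℕ}
    (hK : (K + 1) * φ ≤ Real.pi / 2) (hcos : 1 / 2 ≤ Real.cos φ) :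
    ∃ n : ℕ, ((n + 1 : ℕ) : ℝ) * φ ≤ 3 * Real.pi / 2 ∧ Real.sin ((n + 1 : ℕ) * φ) ≤ -(1 / 2) ∧
      ∀ k < K, Real.sin (((n : ℝ) - k) * φ) ≤ 0 := by
  have hπ := Real.pi_pos
  have hφ2 : φ ≤ Real.pi / 2 := by
    have : 0 ≤ (K : ℝ) * φ := by positivity
    linarith
  have hfl := Nat.floor_le (a := 3 * Real.pi / 2 / φ) (by positivity)
  have hfl' := Nat.lt_floor_add_one (3 * Real.pi / 2 / φ)
  rw [le_div_iff₀ hφ] at hfl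
  rw [div_lt_iff₀ hφ] at hfl'
  obtain ⟨n, hn⟩ : ∃ n, ⌊3 * Real.pi / 2 / φ⌋₊ = n + 1 := by
    refine Nat.exists_eq_succ_of_ne_zero fun h0 => ?_
    rw [h0] at hfl'
    push_cast at hfl'
    linarith
  rw [hn] at hfl hfl'
  refine ⟨n, hfl, ?_, fun k hk => ?_⟩
  · have e : Real.sin ((n + 1 : ℕ) * φ) = -Real.cos (3 * Real.pi / 2 - (n + 1 : ℕ) * φ) := by
      rw [show 3 * Real.pi / 2 - ((n + 1 : ℕ) : ℝ) * φ =
        (Real.pi / 2 - ((n + 1 : ℕ) : ℝ) * φ) + Real.pi by ring, Real.cos_add_pi,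
        Real.cos_pi_div_two_sub, neg_neg]
    rw [e]
    have := Real.cos_le_cos_of_nonneg_of_le_pi
      (x := 3 * Real.pi / 2 - (n + 1 : ℕ) * φ) (y := φ) (by linarith) (by linarith)
      (by push_cast at hfl' ⊢; linarith)
    linarith
  -- Since `(n + 2) φ > 3π/2` and `(k + 2) φ ≤ (K + 1) φ ≤ π/2`, the phase `(n - k) φ` is at least
  -- `π`.
  · have hk' : ((k : ℝ) + 1) * φ ≤ K * φ := by
      gcongr
      exact_mod_cast hk
    have hk0 : 0 ≤ ((k : ℝ) + 1) * φ := by positivity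
    push_cast at hfl hfl'
    exact sin_nonpos_of_mem_pi_two_pi (by linarith) (by linarith)

namespace Model

variable {p : ℤ → ℤ → ℝ} {f : ℕ → ℕ → ℝ}

theorem topError_tendsto_zero (h : Model p f) {y : ℝ} (hy0 : 0 < y) (hy1 : y < 1) (a : ℕ) :
    Tendsto (fun N => topError p f y N a) atTop (𝓝 0) := by
  have edge : ∀ (i : ℤ) (a : ℕ), Tendsto (fun N => topTerm p f y N i a) atTop (𝓝 0) := by
    intro i a
    have e1 := h.column_tendsto_zero a hy0 hy1
    have e2 := (tendsto_add_atTop_iff_nat 1).2 e1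
    have := (e2.const_mul (p i 1 / y)).sub (e1.const_mul (p i (-1) * y))
    simp only [mul_zero, sub_zero] at this
    refine this.congr fun N => ?_
    simp only [topTerm]
    field_simp
    ring
  simpa [topError] using ((edge 1 (a + 2)).add (edge 0 (a + 1))).add (edge (-1) a)

/-- The forcing by the bottom row compensates the sign of the oscillating free solution. -/
theorem corner_le_sum_forcing (h : Model p f) {y ρ m φ : ℝ} (hy0 : 0 < y) (hy1 : y < 1)
    (hρ : 0 < ρ) (h1 : colWeight p 1 y * ρ = m) (h2 : colWeight p (-1) y = m * ρ)
    (h3 : 1 - colWeight p 0 y = 2 * m * Real.cos φ) (hs : 0 ≤ Real.sin φ) {n : ℕ}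
    (hn : Real.sin ((n + 1 : ℕ) * φ) ≤ -(1 / 2)) :
    f 1 1 * y * ρ⁻¹ / 2 ≤ ∑ k ∈ Finset.range n,
      Real.sin (((n : ℝ) - k) * φ) * (forcing p f k * ρ⁻¹ ^ (k + 1) / m) := by
  have hN : ∀ N : ℕ, 1 ≤ N → f 1 1 * y * ρ⁻¹ / 2 ≤ ∑ k ∈ Finset.range n,
      Real.sin (((n : ℝ) - k) * φ) *
        ((forcing p f k - topError p f y N k) * ρ⁻¹ ^ (k + 1) / m) := by
    intro N hN
    have key := chebyshev_recurrence_solution (v := fun k => colSum f y k N * ρ⁻¹ ^ k)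
      (G := fun k => (forcing p f k - topError p f y N k) * ρ⁻¹ ^ (k + 1) / m) (φ := φ)
      (by simp [h.colSum_zero]) (by
        intro k
        rw [← h.colSum_recurrence hy0.ne' k N, h2, h3, ← h1]
        have hc := h.colWeight_one_pos hy0
        simp only [inv_pow]
        field_simp
        ring) n
    -- Column `n + 1` is nonnegative, while the free part is at most minus half the rescaled first
    -- column; the forced part must make up the difference.
    have hl : 0 ≤ colSum f y (n + 1) N * ρ⁻¹ ^ (n + 1) * Real.sin φ :=
      mul_nonneg (mul_nonneg (h.colSum_nonneg hy0.le _ _) (by positivity)) hs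
    rw [key] at hl
    simp only [pow_one] at hl
    have hc : f 1 1 * y ≤ colSum f y 1 N := by
      have := Finset.single_le_sum (s := Finset.range N)
        (f := fun b => f 1 (b + 1) * y ^ (b + 1)) (fun b _ =>
          mul_nonneg (h.f_nonneg _ _) (by positivity)) (Finset.mem_range.2 hN)
      simpa [colSum] using this
    have hc' : f 1 1 * y * ρ⁻¹ ≤ colSum f y 1 N * ρ⁻¹ := by gcongr
    have hc0 : 0 ≤ f 1 1 * y * ρ⁻¹ := mul_nonneg (mul_nonneg (h.f_nonneg _ _) hy0.le)
      (by positivity)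
    nlinarith
  -- With `n` fixed, letting `N → ∞` removes the truncation errors.
  have hlim : Tendsto (fun N : ℕ => ∑ k ∈ Finset.range n, Real.sin (((n : ℝ) - k) * φ) *
        ((forcing p f k - topError p f y N k) * ρ⁻¹ ^ (k + 1) / m)) atTop
      (𝓝 (∑ k ∈ Finset.range n, Real.sin (((n : ℝ) - k) * φ) *
        ((forcing p f k - 0) * ρ⁻¹ ^ (k + 1) / m))) :=
    tendsto_finsetSum _ fun k _ => ((((h.topError_tendsto_zero hy0 hy1 k).const_sub _).mul_const
      _).div_const _).const_mul _
  simp only [sub_zero] at hlim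
  exact ge_of_tendsto hlim (eventually_atTop.2 ⟨1, hN⟩)

theorem forcing_summable (p : ℤ → ℤ → ℝ) {f : ℕ → ℕ → ℝ} (hs : Summable fun a => f (a + 1) 1) :
    Summable (forcing p f) := by
  have h0 : Summable fun a => f a 1 := (summable_nat_add_iff 1).1 hs
  have h2 : Summable fun a => f (a + 2) 1 := (summable_nat_add_iff 2).2 h0
  exact ((h2.mul_left _).add (hs.mul_left _)).add (h0.mul_left _)

/-- Parameters of the oscillation of the recurrence for the columns near the critical point. -/
theorem exists_oscillation_parameters (h : Model p f) : ∃ q C : ℝ, 0 < q ∧ 0 < C ∧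
    ∀ η : ℝ, 0 < η → ∃ y ρ m φ : ℝ, 0 < y ∧ y < 1 ∧ q / 2 ≤ m ∧ 0 < ρ ∧ 1 / 2 ≤ y * ρ⁻¹ ∧
      colWeight p 1 y * ρ = m ∧ colWeight p (-1) y = m * ρ ∧
      1 - colWeight p 0 y = 2 * m * Real.cos φ ∧ 0 < φ ∧ φ ≤ η ∧ 1 / 2 ≤ Real.cos φ ∧
      φ ≤ Real.pi ∧ |Real.log ρ| ≤ C * φ := by
  obtain ⟨δ, hδ, hQ⟩ := h.exists_le_covForm
  set q : ℝ := colWeight p 1 1 with hq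
  have hq0 : 0 < q := h.colWeight_one_pos one_pos
  -- At `y = 1` the characteristic polynomial is `q (t - 1) ^ 2`, so `m → q`, `ρ → 1` and `φ → 0` as
  -- `y → 1`.
  have hqm : colWeight p (-1) 1 = q := by
    have := h.drift_fst
    simp only [hq, colWeight]
    linarith
  have hq2 : 1 - colWeight p 0 1 = 2 * q := by
    have := h.drift_fst
    have := h.sum_eq_one
    have := h.step.zero_zero
    simp only [hq, colWeight]
    linarith
  refine ⟨q, 12 * q / δ + 1, hq0, by positivity, fun η hη => ?_⟩
  have hy : Tendsto (fun s : ℝ => Real.exp (-s)) (𝓝[>] 0) (𝓝 1) := by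
    have : Tendsto (fun s : ℝ => Real.exp (-s)) (𝓝 0) (𝓝 (Real.exp (-0))) :=
      (Real.continuous_exp.comp continuous_neg).tendsto 0
    simp only [neg_zero, Real.exp_zero] at this
    exact this.mono_left nhdsWithin_le_nhds
  have hc : ∀ i, Tendsto (fun s : ℝ => colWeight p i (Real.exp (-s))) (𝓝[>] 0)
      (𝓝 (colWeight p i 1)) := fun i =>
    (continuousAt_colWeight p i one_ne_zero).tendsto.comp hy
  set m : ℝ → ℝ := fun s =>
    √(colWeight p 1 (Real.exp (-s)) * colWeight p (-1) (Real.exp (-s))) with hm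
  have hmlim : Tendsto m (𝓝[>] 0) (𝓝 q) := by
    have := (Real.continuous_sqrt.tendsto _).comp ((hc 1).mul (hc (-1)))
    rwa [hqm, Real.sqrt_mul_self hq0.le] at this
  set ρ : ℝ → ℝ := fun s => m s / colWeight p 1 (Real.exp (-s)) with hρ
  have hρlim : Tendsto ρ (𝓝[>] 0) (𝓝 1) := by
    have := hmlim.div (hc 1) hq0.ne'
    rwa [div_self hq0.ne'] at this
  have hlog : Tendsto (fun s => Real.log (ρ s)) (𝓝[>] 0) (𝓝 0) := by
    have := hρlim.log one_ne_zero
    rwa [Real.log_one] at this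
  set b : ℝ → ℝ := fun s => (1 - colWeight p 0 (Real.exp (-s))) / (2 * m s) with hb
  have hblim : Tendsto b (𝓝[>] 0) (𝓝 1) := by
    have := ((hc 0).const_sub 1).div (hmlim.const_mul 2) (by positivity)
    rwa [hq2, div_self (by positivity)] at this
  have hφlim : Tendsto (fun s => Real.arccos (b s)) (𝓝[>] 0) (𝓝 0) := by
    have := (Real.continuous_arccos.tendsto 1).comp hblim
    rwa [Real.arccos_one] at this
  have hyρ : Tendsto (fun s => Real.exp (-s) * (ρ s)⁻¹) (𝓝[>] 0) (𝓝 1) := by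
    simpa using hy.mul (hρlim.inv₀ one_ne_zero)
  have hev : ∀ᶠ s : ℝ in 𝓝[>] 0, s ∈ Set.Ioc (0 : ℝ) 1 := Ioc_mem_nhdsGT zero_lt_one
  obtain ⟨s, ⟨hs0, hs1⟩, e1, e2, e3, e4, e5, e6⟩ :=
    (hev.and
      ((hmlim.eventually_const_le (u := q / 2) (by linarith)).and
      ((hmlim.eventually_le_const (u := 2 * q) (by linarith)).and
      ((hlog.abs.eventually_le_const (u := 1) (by simp)).and
      ((hblim.eventually_const_le (u := 1 / 2) (by norm_num)).and
      ((hφlim.eventually_le_const (u := η) hη).and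
      (hyρ.eventually_const_le (u := 1 / 2) (by norm_num)))))))).exists
  have hy0 := Real.exp_pos (-s)
  have hy1 : Real.exp (-s) < 1 := by simpa using hs0
  have hA := h.colWeight_one_pos hy0
  have hC := h.colWeight_neg_one_pos hy0
  have hm0 : 0 < m s := by linarith
  have hmm : m s * m s = colWeight p 1 (Real.exp (-s)) * colWeight p (-1) (Real.exp (-s)) :=
    Real.mul_self_sqrt (by positivity)
  have hρ0 : 0 < ρ s := div_pos hm0 hA
  have r1 : colWeight p 1 (Real.exp (-s)) * ρ s = m s := by
    simp only [hρ]
    field_simp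
  have r2 : colWeight p (-1) (Real.exp (-s)) = m s * ρ s := by
    simp only [hρ]
    field_simp
    linarith
  have r2' : colWeight p (-1) (Real.exp (-s)) / ρ s = m s := by
    rw [r2]
    field_simp
  have hker := h.one_lt_kernel hy0 hy1 hρ0
  rw [r1, r2'] at hker
  have hb1 : b s < 1 := by
    simp only [hb]
    rw [div_lt_one (by positivity)]
    linarith
  have hcos : Real.cos (Real.arccos (b s)) = b s := Real.cos_arccos (by linarith) hb1.le
  have hφ0 : 0 < Real.arccos (b s) := Real.arccos_pos.2 hb1
  have r3 : 1 - colWeight p 0 (Real.exp (-s)) = 2 * m s * b s := by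
    simp only [hb]
    field_simp
  refine ⟨Real.exp (-s), ρ s, m s, Real.arccos (b s), hy0, hy1, e1, hρ0, e6, r1, r2,
    by rw [hcos, r3], hφ0, e5, by rw [hcos]; exact e4, Real.arccos_le_pi _, ?_⟩
  -- At `t = ρ` the kernel equals `2 m (1 - cos φ) ≤ 2 q φ ^ 2`, as `m ≤ 2 q`, and is at least `δ
  -- (log ρ) ^ 2 / 6`. The constant `12 q / δ + 1` then avoids a square root, by `x ≤ (x + 1) ^ 2`.
  have hcov := h.covForm_le_kernel (α := Real.log (ρ s)) (s := s) e3
    (by rw [abs_of_pos hs0]; exact hs1)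
  rw [Real.exp_log hρ0, r1, r2', r3] at hcov
  have hQ' := hQ (Real.log (ρ s)) s
  have hcb := Real.one_sub_sq_div_two_le_cos (x := Real.arccos (b s))
  rw [hcos] at hcb
  set φ := Real.arccos (b s)
  set α := Real.log (ρ s)
  have i1 : m s * (1 - b s) ≤ (2 * q) * (φ ^ 2 / 2) :=
    mul_le_mul e2 (by linarith) (by linarith) (by positivity)
  have i2 : δ * α ^ 2 ≤ 12 * q * φ ^ 2 := by
    have : 0 ≤ δ * s ^ 2 := by positivity
    nlinarith
  have i3 : α ^ 2 ≤ 12 * q / δ * φ ^ 2 := by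
    rw [div_mul_eq_mul_div, le_div_iff₀ hδ]
    linarith
  refine abs_le_of_sq_le_sq (i3.trans ?_) (by positivity)
  rw [mul_pow]
  have : 0 ≤ 12 * q / δ := by positivity
  gcongr
  nlinarith

/-- The values of a positive harmonic function along the bottom row are not summable. -/
theorem not_summable_row (h : Model p f) : ¬ Summable fun a => f (a + 1) 1 := by
  intro hsum
  have hr := forcing_summable p hsum
  obtain ⟨q, C, hq, hC, hpar⟩ := h.exists_oscillation_parameters
  have hf := h.harm.pos 1 1 one_pos one_pos
  set E := Real.exp (C * (3 * Real.pi / 2)) with hE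
  have hE0 : 0 < E := Real.exp_pos _
  -- `E` bounds `ρ⁻¹ ^ (k + 1)` over the range where `(k + 1) φ ≤ 3π/2`. As `m ≥ q / 2`, a tail
  -- below this size contributes at most `f 1 1 / 8`, short of the required `f 1 1 / 4`.
  have hε : 0 < q * f 1 1 / (16 * E) := by positivity
  obtain ⟨K, hK⟩ := (hr.hasSum.tendsto_sum_nat.eventually_const_lt
    (sub_lt_self (∑' k, forcing p f k) hε)).exists
  -- `K` is fixed first; `φ` is then so small that the first `K` forcing terms have phases in `[π,
  -- 2π]`.
  obtain ⟨y, ρ, m, φ, hy0, hy1, hm, hρ, hyρ, h1, h2, h3, hφ, hφη, hcos, hφπ, hlog⟩ :=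
    hpar (Real.pi / 2 / (K + 1)) (by positivity)
  rw [le_div_iff₀ (by positivity)] at hφη
  obtain ⟨n, hn, hsin, hneg⟩ :=
    exists_multiple_near_three_pi_div_two hφ (by linarith : ((K : ℝ) + 1) * φ ≤ _) hcos
  have hm0 : 0 < m := by linarith
  have key := h.corner_le_sum_forcing hy0 hy1 hρ h1 h2 h3
    (Real.sin_nonneg_of_nonneg_of_le_pi hφ.le hφπ) hsin
  have hpow : ∀ k < n, ρ⁻¹ ^ (k + 1) ≤ E := by
    intro k hk
    rw [← Real.exp_log (inv_pos.2 hρ), Real.log_inv, ← Real.exp_nat_mul, hE]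
    refine Real.exp_le_exp.2 ?_
    have hk' : ((k + 1 : ℕ) : ℝ) ≤ (n + 1 : ℕ) := by exact_mod_cast (by omega)
    calc ((k + 1 : ℕ) : ℝ) * -Real.log ρ ≤ (k + 1 : ℕ) * (C * φ) := by
          gcongr
          exact (neg_le_abs _).trans hlog
      _ ≤ (n + 1 : ℕ) * (C * φ) := by gcongr
      _ = C * ((n + 1 : ℕ) * φ) := by ring
      _ ≤ C * (3 * Real.pi / 2) := by gcongr
  have hle : ∑ k ∈ Finset.range n,
      Real.sin (((n : ℝ) - k) * φ) * (forcing p f k * ρ⁻¹ ^ (k + 1) / m) ≤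
      ∑ k ∈ Finset.range n, if K ≤ k then forcing p f k * (E / m) else 0 := by
    refine Finset.sum_le_sum fun k hk => ?_
    have hk := Finset.mem_range.1 hk
    have hF := h.forcing_nonneg k
    split_ifs with hKk
    · have hz : 0 ≤ forcing p f k * ρ⁻¹ ^ (k + 1) / m := by positivity
      refine (mul_le_of_le_one_left hz (Real.sin_le_one _)).trans ?_
      rw [mul_div_assoc]
      gcongr
      exact hpow k hk
    · exact mul_nonpos_of_nonpos_of_nonneg (hneg k (by omega)) (by positivity)
  have htail : ∑ k ∈ Finset.range n, (if K ≤ k then forcing p f k * (E / m) else 0) ≤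
      q * f 1 1 / (16 * E) * (E / m) := by
    rw [← Finset.sum_filter, ← Finset.sum_mul]
    gcongr
    have hdis : Disjoint (Finset.range K) {k ∈ Finset.range n | K ≤ k} := by
      rw [Finset.disjoint_left]
      intro k hk hk'
      have := Finset.mem_range.1 hk
      have := (Finset.mem_filter.1 hk').2
      omega
    have := hr.sum_le_tsum (Finset.disjUnion _ _ hdis) fun k _ => h.forcing_nonneg k
    rw [Finset.sum_disjUnion] at this
    linarith
  have hfin : q * f 1 1 / (16 * E) * (E / m) ≤ f 1 1 / 8 := by
    rw [div_mul_div_comm, div_le_div_iff₀ (by positivity) (by positivity)]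
    have : 0 ≤ f 1 1 * E := by positivity
    nlinarith
  have hlow : f 1 1 * (1 / 2) / 2 ≤ f 1 1 * y * ρ⁻¹ / 2 := by
    rw [mul_assoc]
    gcongr
  linarith [hlow.trans (key.trans (hle.trans (htail.trans hfin)))]

/-! ### Values and radii -/

theorem value_one_zero_eq_top (h : Model p f) : value f 1 0 = ⊤ := by
  rw [value_one_zero]
  by_contra hne
  refine h.not_summable_row ?_
  have := ENNReal.summable_toReal hne
  simpa [ENNReal.toReal_ofReal, h.f_nonneg] using this

/-- A radius above 1 would make the series summable at 1; boundedness of `f 1 N * r ^ N` for all `r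
< 1` gives the other inequality. -/
theorem radius_seriesY (h : Model p f) (hns : ¬ Summable fun b => f 1 (b + 1)) :
    (seriesY f).radius = 1 := by
  have hnorm : ∀ n, ‖seriesY f n‖ = f 1 (n + 1) := by
    intro n
    rw [seriesY, FormalMultilinearSeries.ofScalars_norm, Complex.norm_real, Real.norm_eq_abs,
      abs_of_nonneg (h.f_nonneg _ _)]
  refine le_antisymm ?_ ?_
  · by_contra! hlt
    refine hns ?_
    have := (seriesY f).summable_norm_mul_pow (r := 1) (by simpa using hlt)
    simpa [hnorm] using this
  · refine ENNReal.le_of_forall_nnreal_lt fun r hr => ?_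
    have hr1 : (r : ℝ) < 1 := by exact_mod_cast hr
    rcases eq_or_ne r 0 with rfl | hr0
    · simp
    have hr0' : (0 : ℝ) < r := by positivity
    obtain ⟨C, hC⟩ := h.first_column_bounded hr0' hr1
    refine (seriesY f).le_radius_of_bound (C / r) fun n => ?_
    rw [hnorm, le_div_iff₀ hr0', mul_assoc, ← pow_succ]
    exact hC _

end Model

end QuarterPlane

theorem mainTheorem6 (p : ℤ → ℤ → ℝ)
    (h1 : QuarterPlane.IsSmallStep p)
    (h2 : QuarterPlane.IsNonDegenerate p)
    (h3 : QuarterPlane.HasZeroDrift p)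
    (f : ℕ → ℕ → ℝ) (hf : QuarterPlane.IsPositiveHarmonic p f) :
    ((QuarterPlane.seriesX f).radius = 1 ∧ (QuarterPlane.seriesY f).radius = 1) ∧
      (QuarterPlane.value f 1 0 = ⊤ ∧ QuarterPlane.value f 0 1 = ⊤) := by
  have h : QuarterPlane.Model p f := ⟨h1, h2, h3, hf⟩
  refine ⟨⟨h.swap.radius_seriesY h.not_summable_row, h.radius_seriesY h.swap.not_summable_row⟩,
    h.value_one_zero_eq_top, ?_⟩
  have := h.swap.value_one_zero_eq_top
  rwa [QuarterPlane.value_one_zero, ← QuarterPlane.value_zero_one f] at this
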